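/- There exist absolute constants $C_{\rm gap}>0$ and $C>0$ such that the following holds for all integers $p\ge n\ge 1$, all labels $l=(l_1,\dots,l_n)\in\{-1,1\}^n$ and all $\mu\in\mathbb{R}^p$ with $\|\mu\|_2\ge C_{\rm gap}(p/n)^{1/4}$. Let $Y=[Y_1,\dots,Y_n]\in\mathbb{R}^{p\times n}$ with $Y_i=l_i\mu+Z_i$, where $Z_1,\dots,Z_n$ are independent $N(0,I_p)$ random vectors. Let $\hat v\in\mathbb{R}^n$ be a first right singular vector of $Y$, i.e. a (measurably chosen) unit right singular vector belonging to the largest singular value of $Y$, and let $\hat l=\operatorname{sgn}(\hat v)\in\{-1,1\}^n$ be the coordinatewise sign, where $\operatorname{sgn}(0)$ is set to either of the values $\pm1$. Define the misclassification rate $$\mathcal{M}(l,\hat l)=\frac1n\min_{\pi}\bigl|\{i: l_i\ne\pi(\hat l_i)\}\bigr|,$$ the minimum being over the permutations $\pi$ of $\{-1,1\}$. Then $$\mathbb{E}\,\mathcal{M}(l,\hat l)\le C\,\frac{n\|\mu\|_2^2+p}{n\|\mu\|_2^4}.$$ -/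

import Mathlib

open MeasureTheory ProbabilityTheory

noncomputable section

/-- The data matrix `Y = [Y₁ ⋯ Yₙ] ∈ ℝ^{p × n}` with columns `Yᵢ = lᵢ μ + zᵢ`,
for labels `lᵢ ∈ {-1, 1}` (the type `ℤˣ`) and noise vectors `zᵢ`. -/
def dataMatrix {p n : ℕ} (l : Fin n → ℤˣ) (μ : EuclideanSpace ℝ (Fin p))
    (z : Fin n → EuclideanSpace ℝ (Fin p)) : Matrix (Fin p) (Fin n) ℝ :=
  Matrix.of fun a i => ((l i : ℤ) : ℝ) * μ a + z i a

/-- `v` is a first right singular vector of `A`: a unit vector which, with some unit left singular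
vector `u`, satisfies `A v = σ₁ u` and `Aᵀ u = σ₁ v`, where `σ₁` is the largest singular value
of `A` (Mathlib numbers singular values from `0`, in descending order). -/
def IsFirstRightSingularVector {p n : ℕ} (A : Matrix (Fin p) (Fin n) ℝ)
    (v : EuclideanSpace ℝ (Fin n)) : Prop :=
  ‖v‖ = 1 ∧ ∃ u : EuclideanSpace ℝ (Fin p), ‖u‖ = 1 ∧
    A.toEuclideanLin v = A.toEuclideanLin.singularValues 0 • u ∧
    A.transpose.toEuclideanLin u = A.toEuclideanLin.singularValues 0 • v

/-- The sign of a real number as a label in `{-1, 1}`; `s₀` is the label assigned to `0`. -/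
def sgnLabel (s₀ : ℤˣ) (x : ℝ) : ℤˣ :=
  if 0 < x then 1 else if x < 0 then -1 else s₀

/-- The misclassification rate `(1/n) min_π |{i : lᵢ ≠ π(l̂ᵢ)}|`, the minimum being over the
permutations `π` of `{-1, 1}`. -/
def misclassificationRate {n : ℕ} (l lhat : Fin n → ℤˣ) : ℝ :=
  ((Finset.univ.inf' Finset.univ_nonempty fun π : Equiv.Perm ℤˣ =>
    (Finset.univ.filter fun i => l i ≠ π (lhat i)).card : ℕ) : ℝ) / n

end

/-!
Write `w = l / √n`, let `Z` be the noise matrix, and put `A = Zᵀ Z - p I`, so that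
`Y x = √n ⟨w, x⟩ μ + Z x`. A first right singular vector `v` maximizes `‖Y x‖` over unit vectors
`x`; comparing it with `w`, and replacing `v` by `-v` so that `c = ⟨w, v⟩ ≥ 0`, gives
`n ‖μ‖² (1 - c²) ≤ 2 √n ⟨Zᵀ μ, c v - w⟩ + ⟨A (v - w), v + w⟩`.
As `‖c v - w‖² = 1 - c²` and `‖v - w‖² ≤ 2 (1 - c²)`, one factor `√(1 - c²)` cancels and
`(n ‖μ‖²)² (1 - c²) ≤ 8 n ‖Zᵀ μ‖² + 16 ‖A‖²` (`one_sub_inner_sq_le_of_isMax`). This needs neither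
a spectral gap nor any smallness of the noise. The misclassification rate is at most
`2 (1 - c²)` (`misclassificationRate_le_two_mul`), because a wrong sign costs at least `1 / n` in
`‖w ∓ v‖²`.

It remains to take expectations. Here `E ‖Zᵀ μ‖² = n ‖μ‖²`, and `E ‖A‖² = O(p n)`
(`exists_integrable_majorant_opNorm_sq`), by a net argument: `‖A‖` is at most twice the maximum of
`|⟨A x, x⟩| = |‖Z x‖² - p ‖x‖²|` over a set of `exp (O n)` points of norm at most `2`
(`exists_finset_opNorm_le_of_abs_inner_le`), and at each such point this is a scaled centred `χ²`
variable, whose exponential moments of order `± t` with `t` a small multiple of `√(n / p)` are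
`exp (O n)`. Hence `t ‖A‖` is at most a multiple of `n` up to an exponentially integrable error.
-/

/-! ### Nets of the unit ball and operator norms -/

/-- The unit ball of a `d`-dimensional space has a `1/2`-net, inside the ball, of at most `5 ^ d`
points. -/
theorem exists_half_net_unitBall (E : Type*) [NormedAddCommGroup E] [NormedSpace ℝ E]
    [FiniteDimensional ℝ E] :
    ∃ N : Finset E, N.card ≤ 5 ^ Module.finrank ℝ E ∧ (∀ x ∈ N, ‖x‖ ≤ 1) ∧
      ∀ x : E, ‖x‖ ≤ 1 → ∃ y ∈ N, ‖x - y‖ ≤ 1 / 2 := by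
  classical
  -- a `1`-separated subset of the ball of radius `2` of maximal cardinality, scaled by `1/2`
  let Sep : Finset E → Prop := fun s =>
    (∀ c ∈ s, ‖c‖ ≤ 2) ∧ ∀ c ∈ s, ∀ d ∈ s, c ≠ d → 1 ≤ ‖c - d‖
  let K : Set ℕ := {k | ∃ s, Sep s ∧ s.card = k}
  have hne : K.Nonempty := ⟨0, ∅, by simp [Sep], rfl⟩
  have hbdd : BddAbove K := by
    refine ⟨5 ^ Module.finrank ℝ E, ?_⟩
    rintro k ⟨s, hs, rfl⟩
    exact Besicovitch.card_le_of_separated s hs.1 hs.2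
  obtain ⟨s, hs, hcard⟩ := Nat.sSup_mem hne hbdd
  refine ⟨s.image fun c => (2⁻¹ : ℝ) • c,
    Finset.card_image_le.trans (Besicovitch.card_le_of_separated s hs.1 hs.2), ?_, ?_⟩
  · intro x hx
    obtain ⟨c, hc, rfl⟩ := Finset.mem_image.1 hx
    have := hs.1 c hc
    rw [norm_smul]
    norm_num
    linarith
  · intro x hx
    by_contra! hfar
    have hx2 : ‖(2 : ℝ) • x‖ ≤ 2 := by rw [norm_smul]; norm_num; linarith
    have hdist : ∀ c ∈ s, 1 < ‖(2 : ℝ) • x - c‖ := by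
      intro c hc
      have h := hfar _ (Finset.mem_image_of_mem (fun c => (2⁻¹ : ℝ) • c) hc)
      have h2 : (2 : ℝ) • x - c = (2 : ℝ) • (x - (2⁻¹ : ℝ) • c) := by
        rw [smul_sub, smul_smul]; norm_num
      rw [h2, norm_smul]
      norm_num
      linarith
    have hnot : (2 : ℝ) • x ∉ s := fun hmem => by
      have := hdist _ hmem
      rw [sub_self, norm_zero] at this
      linarith
    have hins : Sep (insert ((2 : ℝ) • x) s) := by
      refine ⟨fun c hc => ?_, fun c hc d hd hcd => ?_⟩
      · rcases Finset.mem_insert.1 hc with rfl | hc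
        exacts [hx2, hs.1 c hc]
      · rcases Finset.mem_insert.1 hc with rfl | hc <;> rcases Finset.mem_insert.1 hd with rfl | hd
        · exact absurd rfl hcd
        · exact (hdist d hd).le
        · rw [norm_sub_rev]; exact (hdist c hc).le
        · exact hs.2 c hc d hd hcd
    have hle : (insert ((2 : ℝ) • x) s).card ≤ sSup K := le_csSup hbdd ⟨_, hins, rfl⟩
    rw [Finset.card_insert_of_notMem hnot] at hle
    omega

/-- On a `1/2`-net of the unit ball, a continuous linear map is tested up to a factor `2`. -/
theorem opNorm_le_two_mul_of_half_net {E F : Type*} [NormedAddCommGroup E] [NormedSpace ℝ E]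
    [NormedAddCommGroup F] [NormedSpace ℝ F] {N : Set E}
    (hN : ∀ x : E, ‖x‖ ≤ 1 → ∃ y ∈ N, ‖x - y‖ ≤ 1 / 2) (T : E →L[ℝ] F) {M : ℝ}
    (hM : ∀ y ∈ N, ‖T y‖ ≤ M) : ‖T‖ ≤ 2 * M := by
  have hM0 : 0 ≤ M := by
    obtain ⟨y, hy, -⟩ := hN 0 (by simp)
    exact (norm_nonneg _).trans (hM y hy)
  have key : ‖T‖ ≤ M + ‖T‖ / 2 := by
    refine T.opNorm_le_of_unit_norm (by positivity) fun x hx => ?_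
    obtain ⟨y, hy, hxy⟩ := hN x hx.le
    calc ‖T x‖ = ‖T y + T (x - y)‖ := by rw [map_sub, add_sub_cancel]
      _ ≤ ‖T y‖ + ‖T (x - y)‖ := norm_add_le _ _
      _ ≤ M + ‖T‖ * (1 / 2) :=
          add_le_add (hM y hy) ((T.le_opNorm _).trans (by gcongr))
      _ = M + ‖T‖ / 2 := by ring
  linarith

/-- The quadratic form of a symmetric operator controls its norm through finitely many points,
exponentially many in the dimension: the points are the sums and differences of two points of a
`1/2`-net, and the bilinear form is recovered from the quadratic form by polarization. -/
theorem exists_finset_opNorm_le_of_abs_inner_le (E : Type*) [NormedAddCommGroup E]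
    [InnerProductSpace ℝ E] [FiniteDimensional ℝ E] :
    ∃ S : Finset E, S.card ≤ 2 * 25 ^ Module.finrank ℝ E ∧ (∀ x ∈ S, ‖x‖ ≤ 2) ∧
      ∀ (T : E →L[ℝ] E) (M : ℝ), (T : E →ₗ[ℝ] E).IsSymmetric →
        (∀ x ∈ S, |inner ℝ (T x) x| ≤ M) → ‖T‖ ≤ 2 * M := by
  classical
  obtain ⟨N, hcard, hball, hnet⟩ := exists_half_net_unitBall E
  refine ⟨(N ×ˢ N).image (fun q => q.1 + q.2) ∪ (N ×ˢ N).image (fun q => q.1 - q.2), ?_, ?_, ?_⟩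
  · have h2 : N.card * N.card ≤ 25 ^ Module.finrank ℝ E :=
      (Nat.mul_le_mul hcard hcard).trans (by rw [← mul_pow]; norm_num)
    calc _ ≤ _ := Finset.card_union_le _ _
      _ ≤ (N ×ˢ N).card + (N ×ˢ N).card :=
        add_le_add Finset.card_image_le Finset.card_image_le
      _ ≤ _ := by rw [Finset.card_product]; omega
  · intro x hx
    simp only [Finset.mem_union, Finset.mem_image, Finset.mem_product, Prod.exists] at hx
    rcases hx with ⟨a, b, ⟨ha, hb⟩, rfl⟩ | ⟨a, b, ⟨ha, hb⟩, rfl⟩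
    · exact (norm_add_le _ _).trans (by linarith [hball a ha, hball b hb])
    · exact (norm_sub_le _ _).trans (by linarith [hball a ha, hball b hb])
  · intro T M hT hM
    have hbil : ∀ x ∈ N, ∀ y ∈ N, |inner ℝ (T x) y| ≤ M / 2 := by
      intro x hx y hy
      have h1 := hM (x + y) (Finset.mem_union_left _
        (Finset.mem_image.2 ⟨(x, y), Finset.mk_mem_product hx hy, rfl⟩))
      have h2 := hM (x - y) (Finset.mem_union_right _
        (Finset.mem_image.2 ⟨(x, y), Finset.mk_mem_product hx hy, rfl⟩))
      have hsymm : inner ℝ (T y) x = inner ℝ (T x) y := by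
        rw [real_inner_comm]; exact (hT x y).symm
      rw [map_add, inner_add_left, inner_add_right, inner_add_right, hsymm] at h1
      rw [map_sub, inner_sub_left, inner_sub_right, inner_sub_right, hsymm] at h2
      rw [abs_le] at h1 h2 ⊢
      constructor <;> linarith
    have hT1 : ∀ x ∈ N, ‖T x‖ ≤ M := by
      intro x hx
      have := opNorm_le_two_mul_of_half_net (N := (N : Set E)) hnet (innerSL ℝ (T x)) (M := M / 2)
        (fun y hy => by simpa using hbil x hx y hy)
      rw [innerSL_apply_norm] at this
      linarith
    exact opNorm_le_two_mul_of_half_net (N := (N : Set E)) hnet T hT1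

/-! ### Singular values and perturbation of the leading singular vector -/

theorem norm_apply_le_singularValues_zero_mul {E F : Type*} [NormedAddCommGroup E]
    [InnerProductSpace ℝ E] [FiniteDimensional ℝ E] [NormedAddCommGroup F] [InnerProductSpace ℝ F]
    [FiniteDimensional ℝ F] (T : E →ₗ[ℝ] F) (x : E) :
    ‖T x‖ ≤ T.singularValues 0 * ‖x‖ := by
  have hs := T.isSymmetric_adjoint_comp_self
  let b := hs.eigenvectorBasis rfl
  have hsq : ‖T x‖ ^ 2 ≤ (T.singularValues 0 * ‖x‖) ^ 2 := by
    calc ‖T x‖ ^ 2 = inner ℝ ((LinearMap.adjoint T ∘ₗ T) x) x := by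
          rw [LinearMap.comp_apply, LinearMap.adjoint_inner_left, real_inner_self_eq_norm_sq]
      _ = ∑ i, hs.eigenvalues rfl i * (b.repr x i) ^ 2 := by
          rw [← b.repr.inner_map_map, PiLp.inner_apply]
          refine Finset.sum_congr rfl fun i _ => ?_
          rw [hs.eigenvectorBasis_apply_self_apply rfl x i]
          simp [b]; ring
      _ ≤ ∑ i, T.singularValues 0 ^ 2 * (b.repr x i) ^ 2 := by
          refine Finset.sum_le_sum fun i _ => mul_le_mul_of_nonneg_right ?_ (sq_nonneg _)
          rw [← T.sq_singularValues_fin rfl i]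
          exact pow_le_pow_left₀ (T.singularValues_nonneg _)
            (T.singularValues_antitone (Nat.zero_le _)) 2
      _ = (T.singularValues 0 * ‖x‖) ^ 2 := by
          rw [← Finset.mul_sum, ← EuclideanSpace.real_norm_sq_eq, b.repr.norm_map]; ring
  exact le_of_sq_le_sq hsq (mul_nonneg (T.singularValues_nonneg _) (norm_nonneg _))

/-- A `sin Θ` bound: if `‖a ⟨w, x⟩ m + Z x‖` is at least as large at the unit vector `x = v` as at
`x = w`, the angle between `v` and `w` is controlled by the cross term `Z† m` and by the distance of `Z† Z` to any
multiple `r` of the identity. -/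
theorem one_sub_inner_sq_le_of_isMax {E F : Type*} [NormedAddCommGroup E]
    [InnerProductSpace ℝ E] [CompleteSpace E] [NormedAddCommGroup F] [InnerProductSpace ℝ F]
    [CompleteSpace F] (Z : E →L[ℝ] F) (m : F) (a r : ℝ) (ha : 0 ≤ a) {v w : E} (hv : ‖v‖ = 1)
    (hw : ‖w‖ = 1)
    (hmax : ‖(a * inner ℝ w w) • m + Z w‖ ≤ ‖(a * inner ℝ w v) • m + Z v‖) :
    (a ^ 2 * ‖m‖ ^ 2) ^ 2 * (1 - inner ℝ w v ^ 2) ≤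
      8 * a ^ 2 * ‖Z.adjoint m‖ ^ 2 +
        16 * ‖Z.adjoint ∘L Z - r • ContinuousLinearMap.id ℝ E‖ ^ 2 := by
  -- the claim is invariant under `v ↦ -v`
  wlog hc : 0 ≤ inner ℝ w v generalizing v
  · have := this (v := -v) (by rwa [norm_neg]) (by
      rw [inner_neg_right, map_neg, mul_neg, neg_smul, ← neg_add, norm_neg]; exact hmax)
      (by rw [inner_neg_right]; linarith)
    rwa [inner_neg_right, neg_sq] at this
  set A := Z.adjoint ∘L Z - r • ContinuousLinearMap.id ℝ E with hA
  set c := inner ℝ w v with hcdef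
  have hww : inner ℝ w w = 1 := by rw [real_inner_self_eq_norm_sq, hw]; norm_num
  have hvv : inner ℝ v v = 1 := by rw [real_inner_self_eq_norm_sq, hv]; norm_num
  have hvw : inner ℝ v w = c := real_inner_comm _ _
  have hc1 : c ≤ 1 := by
    have := real_inner_le_norm w v
    rwa [hw, hv, mul_one] at this
  have hs0 : 0 ≤ 1 - c ^ 2 := by nlinarith
  have hAxy : ∀ x y, inner ℝ (A x) y = inner ℝ (Z x) (Z y) - r * inner ℝ x y := by
    intro x y
    simp [hA, inner_sub_left, inner_smul_left, ContinuousLinearMap.adjoint_inner_left]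
  have hquad : ‖Z v‖ ^ 2 - ‖Z w‖ ^ 2 = inner ℝ (A (v - w)) (v + w) := by
    rw [hAxy, map_sub, map_add, inner_sub_left, inner_sub_left, inner_add_right, inner_add_right,
      inner_add_right, inner_add_right, hww, hvv, hvw, ← hcdef, real_inner_self_eq_norm_sq,
      real_inner_self_eq_norm_sq, real_inner_comm (Z v) (Z w)]
    ring
  have hexp : ∀ x, ‖(a * inner ℝ w x) • m + Z x‖ ^ 2 = a ^ 2 * inner ℝ w x ^ 2 * ‖m‖ ^ 2 +
      2 * a * inner ℝ w x * inner ℝ (Z.adjoint m) x + ‖Z x‖ ^ 2 := by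
    intro x
    rw [norm_add_sq_real, norm_smul, inner_smul_left, ContinuousLinearMap.adjoint_inner_left,
      mul_pow, Real.norm_eq_abs, sq_abs]
    simp
    ring
  have hsq := pow_le_pow_left₀ (norm_nonneg _) hmax 2
  rw [hexp, hexp, hww, ← hcdef] at hsq
  set G := ‖Z.adjoint m‖
  set s := √(1 - c ^ 2) with hsdef
  have hs : s ^ 2 = 1 - c ^ 2 := Real.sq_sqrt hs0
  have hsnn : 0 ≤ s := Real.sqrt_nonneg _
  have hcross : inner ℝ (Z.adjoint m) (c • v - w) ≤ G * s := by
    refine (real_inner_le_norm _ _).trans (mul_le_mul_of_nonneg_left ?_ (norm_nonneg _))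
    refine le_of_sq_le_sq (le_of_eq ?_) hsnn
    rw [hs, norm_sub_sq_real, norm_smul, inner_smul_left, hvw, hv, hw, mul_pow, Real.norm_eq_abs,
      sq_abs]
    simp
    ring
  rw [inner_sub_right, inner_smul_right] at hcross
  have hdiff : ‖v - w‖ ≤ √2 * s := by
    refine le_of_sq_le_sq ?_ (by positivity)
    rw [mul_pow, hs, norm_sub_sq_real, hv, hw, hvw, Real.sq_sqrt (by norm_num)]
    nlinarith
  have hsum : ‖v + w‖ ≤ 2 := (norm_add_le _ _).trans (by rw [hv, hw]; norm_num)
  have hAvw : inner ℝ (A (v - w)) (v + w) ≤ ‖A‖ * (√2 * s) * 2 :=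
    (real_inner_le_norm _ _).trans (mul_le_mul ((A.le_opNorm _).trans (by gcongr)) hsum
      (norm_nonneg _) (by positivity))
  have hlin : a ^ 2 * ‖m‖ ^ 2 * s ^ 2 ≤ (2 * a * G + 2 * √2 * ‖A‖) * s := by
    have h := mul_le_mul_of_nonneg_left hcross (mul_nonneg zero_le_two ha)
    rw [hs]
    nlinarith
  rw [← hs]
  have hlin' : a ^ 2 * ‖m‖ ^ 2 * s ≤ 2 * a * G + 2 * √2 * ‖A‖ := by
    rcases hsnn.eq_or_lt with h0 | hpos
    · rw [← h0, mul_zero]; positivity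
    · refine le_of_mul_le_mul_right ?_ hpos
      linarith
  calc (a ^ 2 * ‖m‖ ^ 2) ^ 2 * s ^ 2 = (a ^ 2 * ‖m‖ ^ 2 * s) ^ 2 := by ring
    _ ≤ (2 * a * G + 2 * √2 * ‖A‖) ^ 2 := pow_le_pow_left₀ (by positivity) hlin' 2
    _ ≤ 2 * ((2 * a * G) ^ 2 + (2 * √2 * ‖A‖) ^ 2) := add_sq_le
    _ = _ := by rw [mul_pow (2 * √2), mul_pow 2 √2, Real.sq_sqrt (by norm_num)]; ring

/-! ### Exponential moments of Gaussian quadratic forms -/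

theorem one_le_one_sub_mul_exp {u : ℝ} (hu : |u| ≤ 1 / 2) :
    1 ≤ (1 - u) * Real.exp (u + u ^ 2) := by
  rw [abs_le] at hu
  rcases le_total u 0 with h | h
  · have h1 := Real.add_one_le_exp (u + u ^ 2)
    nlinarith [mul_nonneg (neg_nonneg.2 h) (sq_nonneg u)]
  · have h1 := Real.quadratic_le_exp_of_nonneg (x := u + u ^ 2) (by positivity)
    have h2 : 1 ≤ (1 - u) * (1 + (u + u ^ 2) + (u + u ^ 2) ^ 2 / 2) := by
      have : (1 - u) * (1 + (u + u ^ 2) + (u + u ^ 2) ^ 2 / 2) - 1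
          = u ^ 2 * ((1 - 2 * u) + u * (1 - u - u ^ 2)) / 2 := by ring
      have h3 : 0 ≤ u ^ 2 * ((1 - 2 * u) + u * (1 - u - u ^ 2)) / 2 := by
        have : 0 ≤ u * (1 - u - u ^ 2) := mul_nonneg h (by nlinarith)
        have : 0 ≤ 1 - 2 * u := by linarith
        positivity
      linarith
    exact h2.trans (mul_le_mul_of_nonneg_left h1 (by linarith))

theorem integral_exp_mul_sq_sub_one_gaussianReal {τ : ℝ} (hτ : τ < 1 / 2) :
    ∫ x, Real.exp (τ * (x ^ 2 - 1)) ∂(gaussianReal 0 1) = Real.exp (-τ) / √(1 - 2 * τ) := by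
  rw [integral_gaussianReal_eq_integral_smul one_ne_zero]
  have h : ∀ x : ℝ, gaussianPDFReal 0 1 x • Real.exp (τ * (x ^ 2 - 1)) =
      ((√(2 * Real.pi))⁻¹ * Real.exp (-τ)) * Real.exp (-(1 / 2 - τ) * x ^ 2) := by
    intro x
    rw [gaussianPDFReal, smul_eq_mul, NNReal.coe_one, mul_one, mul_assoc, mul_assoc, ← Real.exp_add,
      ← Real.exp_add]
    congr 2
    ring
  simp_rw [h]
  rw [integral_const_mul, integral_gaussian]
  have h1 : 0 < 1 - 2 * τ := by linarith
  have h2 : Real.pi / (1 / 2 - τ) = 2 * Real.pi / (1 - 2 * τ) := by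
    have : (1 / 2 - τ) ≠ 0 := by linarith
    field_simp
  rw [h2, Real.sqrt_div (by positivity)]
  have h3 : √(2 * Real.pi) ≠ 0 := by positivity
  field_simp

theorem integral_exp_mul_sq_sub_one_gaussianReal_le {τ : ℝ} (hτ : |τ| ≤ 1 / 4) :
    ∫ x, Real.exp (τ * (x ^ 2 - 1)) ∂(gaussianReal 0 1) ≤ Real.exp (2 * τ ^ 2) := by
  have hτ' := abs_le.1 hτ
  rw [integral_exp_mul_sq_sub_one_gaussianReal (by linarith),
    div_le_iff₀ (Real.sqrt_pos.2 (by linarith))]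
  refine le_of_sq_le_sq ?_ (by positivity)
  rw [mul_pow, Real.sq_sqrt (by linarith), ← Real.exp_nat_mul, ← Real.exp_nat_mul]
  have h := one_le_one_sub_mul_exp (u := 2 * τ) (by rw [abs_mul]; norm_num; linarith)
  have h2 := mul_le_mul_of_nonneg_right h (Real.exp_pos (-(2 * τ))).le
  rw [one_mul, mul_assoc, ← Real.exp_add] at h2
  rw [mul_comm (1 - 2 * τ)] at h2
  convert h2 using 2
  · push_cast; ring
  · congr 1; push_cast; ring

theorem integral_exp_mul_norm_sq_sub_stdGaussian (p : ℕ) (τ : ℝ) :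
    ∫ g, Real.exp (τ * (‖g‖ ^ 2 - p)) ∂(stdGaussian (EuclideanSpace ℝ (Fin p))) =
      (∫ x, Real.exp (τ * (x ^ 2 - 1)) ∂(gaussianReal 0 1)) ^ p := by
  rw [← map_pi_eq_stdGaussian, integral_map (by fun_prop) (by fun_prop)]
  have h : ∀ x : Fin p → ℝ, Real.exp (τ * (‖WithLp.toLp 2 x‖ ^ 2 - p)) =
      ∏ i, Real.exp (τ * (x i ^ 2 - 1)) := by
    intro x
    rw [← Real.exp_sum, EuclideanSpace.real_norm_sq_eq, ← Finset.mul_sum, Finset.sum_sub_distrib]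
    simp
  simp_rw [h]
  rw [integral_fintype_prod_eq_pow (fun x : ℝ => Real.exp (τ * (x ^ 2 - 1))), Fintype.card_fin]

/-- A linear combination of independent standard Gaussian vectors with coefficients `x` is
distributed as a standard Gaussian vector multiplied by `‖x‖`. -/
theorem hasLaw_sum_smul_stdGaussian {Ω : Type*} [MeasurableSpace Ω]
    {P : Measure Ω} [IsProbabilityMeasure P] {n : ℕ} {F : Type*}
    [NormedAddCommGroup F] [InnerProductSpace ℝ F] [FiniteDimensional ℝ F] [MeasurableSpace F]
    [BorelSpace F] {Z : Fin n → Ω → F} (hZ : ∀ i, HasLaw (Z i) (stdGaussian F) P)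
    (hind : iIndepFun Z P) (x : EuclideanSpace ℝ (Fin n)) :
    HasLaw (fun ω => ∑ i, x i • Z i ω) ((stdGaussian F).map fun g => ‖x‖ • g) P := by
  have hm : ∀ i, AEMeasurable (fun ω => x i • Z i ω) P :=
    fun i => (hZ i).aemeasurable.const_smul _
  have hms : AEMeasurable (fun ω => ∑ i, x i • Z i ω) P :=
    Finset.aemeasurable_fun_sum _ fun i _ => hm i
  refine ⟨hms, ?_⟩
  have : IsProbabilityMeasure (P.map fun ω => ∑ i, x i • Z i ω) :=
    Measure.isProbabilityMeasure_map hms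
  have : IsProbabilityMeasure ((stdGaussian F).map fun g => ‖x‖ • g) :=
    Measure.isProbabilityMeasure_map (by fun_prop)
  refine Measure.ext_of_charFun ?_
  have hind' : iIndepFun (fun i ω => x i • Z i ω) P :=
    hind.comp (fun i g => x i • g) fun i => measurable_const_smul _
  rw [hind'.charFun_map_fun_sum_eq_prod hm]
  ext t
  rw [charFun_map_smul, charFun_stdGaussian, Finset.prod_apply]
  have h : ∀ i, charFun (P.map fun ω => x i • Z i ω) t =
      Complex.exp (-((x i ^ 2 * ‖t‖ ^ 2 : ℝ) : ℂ) / 2) := by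
    intro i
    rw [charFun_map_smul_comp (hZ i).aemeasurable, (hZ i).map_eq, charFun_stdGaussian, norm_smul]
    congr 3
    push_cast
    rw [mul_pow, ← Complex.ofReal_pow, Real.norm_eq_abs, sq_abs, Complex.ofReal_pow]
  simp_rw [h]
  rw [← Complex.exp_sum, norm_smul, ← Finset.sum_div, Finset.sum_neg_distrib, ← Complex.ofReal_sum,
    ← Finset.sum_mul, ← EuclideanSpace.real_norm_sq_eq, norm_norm]
  push_cast
  rw [mul_pow]

/-- Sub-exponential bound for a centred `χ²` variable with `p` degrees of freedom. -/
theorem integrable_and_integral_exp_norm_sq_sum_smul_le {Ω : Type*} [MeasurableSpace Ω]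
    {P : Measure Ω} [IsProbabilityMeasure P] {n p : ℕ}
    {Z : Fin n → Ω → EuclideanSpace ℝ (Fin p)}
    (hZ : ∀ i, HasLaw (Z i) (stdGaussian (EuclideanSpace ℝ (Fin p))) P)
    (hind : iIndepFun Z P) (x : EuclideanSpace ℝ (Fin n)) {t : ℝ} (ht : |t| * ‖x‖ ^ 2 ≤ 1 / 4) :
    Integrable (fun ω => Real.exp (t * (‖∑ i, x i • Z i ω‖ ^ 2 - p * ‖x‖ ^ 2))) P ∧
      ∫ ω, Real.exp (t * (‖∑ i, x i • Z i ω‖ ^ 2 - p * ‖x‖ ^ 2)) ∂P ≤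
        Real.exp (2 * p * (t * ‖x‖ ^ 2) ^ 2) := by
  have hτ : |t * ‖x‖ ^ 2| ≤ 1 / 4 := by rwa [abs_mul, abs_of_nonneg (sq_nonneg ‖x‖)]
  have key : ∫ ω, Real.exp (t * (‖∑ i, x i • Z i ω‖ ^ 2 - p * ‖x‖ ^ 2)) ∂P =
      (∫ y, Real.exp (t * ‖x‖ ^ 2 * (y ^ 2 - 1)) ∂(gaussianReal 0 1)) ^ p := by
    rw [← integral_exp_mul_norm_sq_sub_stdGaussian]
    have := (hasLaw_sum_smul_stdGaussian hZ hind x).integral_comp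
      (f := fun g => Real.exp (t * (‖g‖ ^ 2 - p * ‖x‖ ^ 2))) (by fun_prop)
    rw [Function.comp_def] at this
    rw [this, integral_map (by fun_prop) (by fun_prop)]
    congr 1
    ext g
    rw [norm_smul, norm_norm]
    congr 1
    ring
  have hpos : 0 < ∫ y, Real.exp (t * ‖x‖ ^ 2 * (y ^ 2 - 1)) ∂(gaussianReal 0 1) := by
    have h1 : t * ‖x‖ ^ 2 < 1 / 2 := by linarith [(abs_le.1 hτ).2]
    rw [integral_exp_mul_sq_sub_one_gaussianReal h1]
    exact div_pos (Real.exp_pos _) (Real.sqrt_pos.2 (by linarith))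
  constructor
  · refine Integrable.of_integral_ne_zero ?_
    rw [key]
    positivity
  · rw [key]
    refine (pow_le_pow_left₀ hpos.le (integral_exp_mul_sq_sub_one_gaussianReal_le hτ) p).trans ?_
    rw [← Real.exp_nat_mul]
    apply le_of_eq
    congr 1
    ring

theorem integrable_and_integral_inner_sq_stdGaussian {Ω : Type*} [MeasurableSpace Ω]
    {P : Measure Ω} {F : Type*} [NormedAddCommGroup F]
    [InnerProductSpace ℝ F] [FiniteDimensional ℝ F] [MeasurableSpace F] [BorelSpace F]
    {X : Ω → F} (hX : HasLaw X (stdGaussian F) P) (m : F) :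
    Integrable (fun ω => inner ℝ m (X ω) ^ 2) P ∧ ∫ ω, inner ℝ m (X ω) ^ 2 ∂P = ‖m‖ ^ 2 := by
  have hL : MemLp (innerSL ℝ m) 2 (stdGaussian F) := IsGaussian.memLp_dual _ _ _ (by norm_num)
  have hsq : Integrable (fun g : F => inner ℝ m g ^ 2) (stdGaussian F) := by
    simpa using hL.integrable_sq
  constructor
  · have h := hX.map_eq ▸ hsq
    exact h.comp_aemeasurable hX.aemeasurable
  · have h := hX.integral_comp (f := fun g : F => inner ℝ m g ^ 2) (by fun_prop)
    rw [Function.comp_def] at h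
    rw [h]
    have hvar := variance_dual_stdGaussian (innerSL ℝ m)
    rw [variance_eq_sub hL, integral_strongDual_stdGaussian, innerSL_apply_norm] at hvar
    simpa using hvar

/-- A quadratic is dominated by a constant and an exponential; the factor `exp (-b)` compensates an
exponential bound `W` whose expectation is `exp b`. -/
theorem sq_le_two_mul_sq_add_exp {X b W : ℝ} (hW : Real.exp |X| ≤ W) :
    X ^ 2 ≤ 2 * b ^ 2 + 4 * Real.exp (-b) * W := by
  have hW0 : 0 < W := (Real.exp_pos _).trans_le hW
  rw [← sq_abs X]
  rcases le_total |X| b with h | h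
  · have : |X| ^ 2 ≤ b ^ 2 := pow_le_pow_left₀ (abs_nonneg X) h 2
    have : 0 ≤ 4 * Real.exp (-b) * W := by positivity
    nlinarith [sq_nonneg b]
  · have hq := Real.quadratic_le_exp_of_nonneg (sub_nonneg.2 h)
    have he : Real.exp (|X| - b) ≤ Real.exp (-b) * W := by
      rw [sub_eq_neg_add, Real.exp_add]
      gcongr
    nlinarith [sq_nonneg (|X| - 2 * b)]

/-! ### The operator norm of a centred Gram matrix -/

/-- The linear map `x ↦ ∑ i, x i • z i`, i.e. the matrix with columns `z i`. -/
noncomputable def columnMap {n : ℕ} {F : Type*} [NormedAddCommGroup F] [NormedSpace ℝ F]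
    (z : Fin n → F) : EuclideanSpace ℝ (Fin n) →L[ℝ] F :=
  ∑ i, (EuclideanSpace.proj i : EuclideanSpace ℝ (Fin n) →L[ℝ] ℝ).smulRight (z i)

theorem columnMap_apply {n : ℕ} {F : Type*} [NormedAddCommGroup F] [NormedSpace ℝ F]
    (z : Fin n → F) (x : EuclideanSpace ℝ (Fin n)) : columnMap z x = ∑ i, x i • z i := by
  simp [columnMap]

theorem norm_sq_adjoint_columnMap {n : ℕ} {F : Type*} [NormedAddCommGroup F]
    [InnerProductSpace ℝ F] [CompleteSpace F] (z : Fin n → F) (m : F) :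
    ‖(columnMap z).adjoint m‖ ^ 2 = ∑ i, inner ℝ m (z i) ^ 2 := by
  rw [EuclideanSpace.real_norm_sq_eq]
  refine Finset.sum_congr rfl fun i _ => ?_
  have h : inner ℝ ((columnMap z).adjoint m) (EuclideanSpace.single i 1) = inner ℝ m (z i) := by
    rw [ContinuousLinearMap.adjoint_inner_left, columnMap_apply]
    simp
  rw [← h]
  simp [EuclideanSpace.inner_single_right]

/-- For a `p × n` matrix with standard Gaussian columns, `‖Zᵀ Z - p I‖ ^ 2` is dominated by an
integrable variable of expectation `O(p n)`. -/
theorem exists_integrable_majorant_opNorm_sq {Ω : Type*} [MeasurableSpace Ω] {P : Measure Ω}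
    [IsProbabilityMeasure P] {n p : ℕ} (hn : 1 ≤ n) (hnp : n ≤ p)
    {Z : Fin n → Ω → EuclideanSpace ℝ (Fin p)}
    (hZ : ∀ i, HasLaw (Z i) (stdGaussian (EuclideanSpace ℝ (Fin p))) P) (hind : iIndepFun Z P) :
    ∃ H : Ω → ℝ, Integrable H P ∧ ∫ ω, H ω ∂P ≤ 77824 * (p * n) ∧
      ∀ ω, ‖(columnMap fun i => Z i ω).adjoint ∘L (columnMap fun i => Z i ω) -
        (p : ℝ) • ContinuousLinearMap.id ℝ (EuclideanSpace ℝ (Fin n))‖ ^ 2 ≤ H ω := by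
  obtain ⟨S, hScard, hSnorm, hS⟩ :=
    exists_finset_opNorm_le_of_abs_inner_le (EuclideanSpace ℝ (Fin n))
  rw [finrank_euclideanSpace_fin] at hScard
  have hn0 : (1 : ℝ) ≤ n := by exact_mod_cast hn
  have hnp' : (n : ℝ) ≤ p := by exact_mod_cast hnp
  have hp0 : (0 : ℝ) < p := by linarith
  -- the scale `t` at which the union bound over `S` costs only a factor `exp (O n)`
  set t : ℝ := √(n / p) / 16 with ht
  have htpos : 0 < t := by positivity
  have htsq : t ^ 2 = n / p / 256 := by
    rw [ht, div_pow, Real.sq_sqrt (by positivity)]; norm_num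
  have ht16 : t ≤ 1 / 16 := by
    have : √((n : ℝ) / p) ≤ 1 := Real.sqrt_le_one.2 ((div_le_one hp0).2 hnp')
    rw [ht]; linarith
  let q : EuclideanSpace ℝ (Fin n) → Ω → ℝ := fun x ω => ‖∑ i, x i • Z i ω‖ ^ 2 - p * ‖x‖ ^ 2
  have hexp : ∀ x ∈ S, ∀ τ : ℝ, |τ| = t → Integrable (fun ω => Real.exp (τ * q x ω)) P ∧
      ∫ ω, Real.exp (τ * q x ω) ∂P ≤ Real.exp (n / 8) := by
    intro x hx τ hτ
    have hx4 : ‖x‖ ^ 2 ≤ 4 := by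
      have := pow_le_pow_left₀ (norm_nonneg x) (hSnorm x hx) 2
      linarith
    have h := integrable_and_integral_exp_norm_sq_sum_smul_le hZ hind x (t := τ) (by
      rw [hτ]; nlinarith)
    refine ⟨h.1, h.2.trans (Real.exp_le_exp.2 ?_)⟩
    have hx16 : (‖x‖ ^ 2) ^ 2 ≤ 16 := by
      have := pow_le_pow_left₀ (by positivity) hx4 2
      linarith
    rw [mul_pow, ← sq_abs τ, hτ, htsq]
    calc 2 * (p : ℝ) * (n / p / 256 * (‖x‖ ^ 2) ^ 2) = (n : ℝ) / 128 * (‖x‖ ^ 2) ^ 2 := by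
          field_simp; ring
      _ ≤ (n : ℝ) / 128 * 16 := by gcongr
      _ = n / 8 := by ring
  let W : Ω → ℝ := fun ω => ∑ x ∈ S, (Real.exp (t * q x ω) + Real.exp (-t * q x ω))
  have hWint : Integrable W P := integrable_finsetSum _ fun x hx =>
    ((hexp x hx t (abs_of_pos htpos)).1.add
      (hexp x hx (-t) (by rw [abs_neg, abs_of_pos htpos])).1)
  have hWle : ∫ ω, W ω ∂P ≤ Real.exp (6 * n) := by
    have h1 : ∫ ω, W ω ∂P ≤ ∑ _x ∈ S, 2 * Real.exp (n / 8) := by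
      refine (integral_finsetSum S fun x hx => ((hexp x hx t (abs_of_pos htpos)).1.add
        (hexp x hx (-t) (by rw [abs_neg, abs_of_pos htpos])).1)).trans_le ?_
      refine Finset.sum_le_sum fun x hx => ?_
      have ha := hexp x hx t (abs_of_pos htpos)
      have hb := hexp x hx (-t) (by rw [abs_neg, abs_of_pos htpos])
      refine (integral_add ha.1 hb.1).trans_le ?_
      linarith [ha.2, hb.2]
    refine h1.trans ?_
    rw [Finset.sum_const, nsmul_eq_mul]
    have hcard : (S.card : ℝ) ≤ 2 * 25 ^ n := by exact_mod_cast hScard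
    -- the exponent `6 n` leaves room for the `2 * 25 ^ n` points, both signs, and `exp (n / 8)`
    have h4 : (4 : ℝ) ≤ 4 ^ n := le_self_pow₀ (by norm_num) (by omega)
    have h100 : (100 : ℝ) ≤ Real.exp 5 := by
      have h := pow_le_pow_left₀ (by norm_num) Real.exp_one_gt_d9.le 5
      rw [← Real.exp_nat_mul] at h
      norm_num at h
      linarith
    calc (S.card : ℝ) * (2 * Real.exp (n / 8)) ≤ 2 * 25 ^ n * (2 * Real.exp (n / 8)) := by gcongr
      _ = 4 * 25 ^ n * Real.exp (n / 8) := by ring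
      _ ≤ 4 ^ n * 25 ^ n * Real.exp n := by gcongr; linarith
      _ = 100 ^ n * Real.exp n := by rw [← mul_pow]; norm_num
      _ ≤ Real.exp 5 ^ n * Real.exp n := by gcongr
      _ = Real.exp (6 * n) := by rw [← Real.exp_nat_mul, ← Real.exp_add]; congr 1; ring
  let R : Ω → ℝ := fun ω => 2 * (6 * (n : ℝ)) ^ 2 + 4 * Real.exp (-(6 * n)) * W ω
  have hRint : Integrable R P := (integrable_const _).add (hWint.const_mul _)
  refine ⟨fun ω => 4 / t ^ 2 * R ω, hRint.const_mul _, ?_, fun ω => ?_⟩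
  · have hR : ∫ ω, R ω ∂P ≤ 76 * n ^ 2 := by
      have h0 : ∫ ω, R ω ∂P = 2 * (6 * (n : ℝ)) ^ 2 + 4 * Real.exp (-(6 * n)) * ∫ ω, W ω ∂P := by
        rw [integral_add (integrable_const _) (hWint.const_mul _),
          integral_const_mul (4 * Real.exp (-(6 * (n : ℝ)))) W]
        simp
      have h1 : Real.exp (-(6 * n)) * ∫ ω, W ω ∂P ≤ 1 := by
        refine (mul_le_mul_of_nonneg_left hWle (Real.exp_pos _).le).trans (le_of_eq ?_)
        rw [← Real.exp_add, neg_add_cancel, Real.exp_zero]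
      rw [h0]
      nlinarith
    rw [integral_const_mul, htsq]
    calc 4 / ((n : ℝ) / p / 256) * ∫ ω, R ω ∂P ≤ 4 / ((n : ℝ) / p / 256) * (76 * n ^ 2) := by gcongr
      _ = 77824 * (p * n) := by field_simp; norm_num
  · set A := (columnMap fun i => Z i ω).adjoint ∘L (columnMap fun i => Z i ω) -
        (p : ℝ) • ContinuousLinearMap.id ℝ (EuclideanSpace ℝ (Fin n)) with hA
    have hAxy : ∀ x y, inner ℝ (A x) y = inner ℝ (columnMap (fun i => Z i ω) x)
        (columnMap (fun i => Z i ω) y) - p * inner ℝ x y := by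
      intro x y
      simp [hA, inner_sub_left, inner_smul_left, ContinuousLinearMap.adjoint_inner_left]
    have hsymm : (A : EuclideanSpace ℝ (Fin n) →ₗ[ℝ] EuclideanSpace ℝ (Fin n)).IsSymmetric := by
      intro x y
      change inner ℝ (A x) y = inner ℝ x (A y)
      rw [real_inner_comm (A y) x, hAxy, hAxy, real_inner_comm x y, real_inner_comm (columnMap _ x)]
    have hbound : ∀ x ∈ S, |inner ℝ (A x) x| ≤ √(R ω) / t := by
      intro x hx
      have hq : inner ℝ (A x) x = q x ω := by
        rw [hAxy, real_inner_self_eq_norm_sq, real_inner_self_eq_norm_sq, columnMap_apply]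
      rw [hq, le_div_iff₀ htpos, ← abs_of_pos htpos, ← abs_mul, mul_comm]
      refine Real.abs_le_sqrt (sq_le_two_mul_sq_add_exp ?_)
      refine le_trans ?_ (Finset.single_le_sum (f := fun x =>
        Real.exp (t * q x ω) + Real.exp (-t * q x ω)) (fun x _ => by positivity) hx)
      simp only [neg_mul]
      rcases abs_cases (t * q x ω) with h | h <;> rw [h.1] <;>
        linarith [Real.exp_pos (t * q x ω), Real.exp_pos (-(t * q x ω))]
    have hR0 : 0 ≤ R ω := by
      have : 0 ≤ W ω := Finset.sum_nonneg fun x _ => by positivity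
      positivity
    calc ‖A‖ ^ 2 ≤ (2 * (√(R ω) / t)) ^ 2 :=
          pow_le_pow_left₀ (norm_nonneg _) (hS A _ hsymm hbound) 2
      _ = 4 / t ^ 2 * R ω := by
          rw [mul_pow, div_pow, Real.sq_sqrt hR0]; ring

/-! ### Misclassification by the leading singular vector -/

/-- The unit vector `l / √n` with the signs of the labels `l`. -/
noncomputable def labelDirection {n : ℕ} (l : Fin n → ℤˣ) : EuclideanSpace ℝ (Fin n) :=
  WithLp.toLp 2 fun i => ((l i : ℤ) : ℝ) / √n

theorem intCast_unit_sq (u : ℤˣ) : ((u : ℤ) : ℝ) ^ 2 = 1 := by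
  rcases Int.units_eq_one_or u with rfl | rfl <;> simp

theorem norm_labelDirection {n : ℕ} (hn : 1 ≤ n) (l : Fin n → ℤˣ) : ‖labelDirection l‖ = 1 := by
  have hn0 : (n : ℝ) ≠ 0 := by positivity
  have h : ‖labelDirection l‖ ^ 2 = 1 := by
    rw [EuclideanSpace.real_norm_sq_eq]
    simp [labelDirection, div_pow, intCast_unit_sq, hn0]
  exact (pow_eq_one_iff_of_nonneg (norm_nonneg _) two_ne_zero).1 h

theorem toEuclideanLin_dataMatrix_apply {n p : ℕ} (hn : 1 ≤ n) (l : Fin n → ℤˣ)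
    (μ : EuclideanSpace ℝ (Fin p)) (z : Fin n → EuclideanSpace ℝ (Fin p))
    (x : EuclideanSpace ℝ (Fin n)) :
    (dataMatrix l μ z).toEuclideanLin x =
      (√n * inner ℝ (labelDirection l) x) • μ + columnMap z x := by
  have hn0 : √(n : ℝ) ≠ 0 := by positivity
  ext a
  rw [columnMap_apply]
  simp only [Matrix.toLpLin_apply, Matrix.mulVec, dotProduct, dataMatrix, Matrix.of_apply,
    PiLp.add_apply, PiLp.smul_apply, WithLp.ofLp_sum, Finset.sum_apply, WithLp.ofLp_smul,
    Pi.smul_apply, smul_eq_mul, PiLp.inner_apply, labelDirection, RCLike.inner_apply, conj_trivial,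
    Finset.mul_sum, Finset.sum_mul, ← Finset.sum_add_distrib]
  refine Finset.sum_congr rfl fun i _ => ?_
  field_simp

theorem sgnLabel_mul_nonneg (s₀ : ℤˣ) (x : ℝ) : 0 ≤ ((sgnLabel s₀ x : ℤ) : ℝ) * x := by
  unfold sgnLabel
  split_ifs with h1 h2
  · simpa using h1.le
  · simpa using h2.le
  · rw [le_antisymm (not_lt.1 h1) (not_lt.1 h2), mul_zero]

/-- Every misclassified coordinate contributes at least `1 / n` to `‖l / √n ∓ v‖ ^ 2`. -/
theorem misclassificationRate_le_two_mul {n : ℕ} (hn : 1 ≤ n) (l : Fin n → ℤˣ) (s₀ : ℤˣ)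
    (v : EuclideanSpace ℝ (Fin n)) (hv : ‖v‖ = 1) :
    misclassificationRate l (fun i => sgnLabel s₀ (v i)) ≤
      2 * (1 - inner ℝ (labelDirection l) v ^ 2) := by
  have hn0 : (0 : ℝ) < n := by positivity
  -- the relabelling `π` is multiplication by the sign `ε` of `⟨l, v⟩`
  have key : ∀ ε : ℤˣ, misclassificationRate l (fun i => sgnLabel s₀ (v i)) ≤
      2 - 2 * (((ε : ℤ) : ℝ) * inner ℝ (labelDirection l) v) := by
    intro ε
    have hmin : misclassificationRate l (fun i => sgnLabel s₀ (v i)) ≤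
        ((Finset.univ.filter fun i => l i ≠ ε * sgnLabel s₀ (v i)).card : ℝ) / n := by
      unfold misclassificationRate
      gcongr
      exact Finset.inf'_le (fun π : Equiv.Perm ℤˣ =>
        (Finset.univ.filter fun i => l i ≠ π (sgnLabel s₀ (v i))).card)
        (Finset.mem_univ (Equiv.mulLeft ε))
    refine hmin.trans ?_
    have hsum : ((Finset.univ.filter fun i => l i ≠ ε * sgnLabel s₀ (v i)).card : ℝ) / n ≤
        ‖labelDirection l - ((ε : ℤ) : ℝ) • v‖ ^ 2 := by
      rw [EuclideanSpace.real_norm_sq_eq, div_eq_mul_inv, ← nsmul_eq_mul, ← Finset.sum_const]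
      refine (Finset.sum_le_sum fun i hi => ?_).trans
        (Finset.sum_le_sum_of_subset_of_nonneg (Finset.subset_univ _) fun i _ _ => sq_nonneg _)
      have hi' : l i = -(ε * sgnLabel s₀ (v i)) :=
        Int.units_ne_iff_eq_neg.1 (Finset.mem_filter.1 hi).2
      have hcoord : (labelDirection l - ((ε : ℤ) : ℝ) • v) i =
          ((l i : ℤ) : ℝ) / √n - ((ε : ℤ) : ℝ) * v i := by
        simp [labelDirection]
      have hneg : ((l i : ℤ) : ℝ) * (((ε : ℤ) : ℝ) * v i) ≤ 0 := by
        rw [hi']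
        push_cast
        nlinarith [sgnLabel_mul_nonneg s₀ (v i), intCast_unit_sq ε]
      have hdiv : ((l i : ℤ) : ℝ) / √n * (((ε : ℤ) : ℝ) * v i) ≤ 0 := by
        rw [div_mul_eq_mul_div]
        exact div_nonpos_of_nonpos_of_nonneg hneg (Real.sqrt_nonneg _)
      have hsq : (((l i : ℤ) : ℝ) / √n) ^ 2 = (n : ℝ)⁻¹ := by
        rw [div_pow, intCast_unit_sq, Real.sq_sqrt hn0.le, one_div]
      rw [hcoord, ← hsq]
      nlinarith [sq_nonneg (((ε : ℤ) : ℝ) * v i)]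
    refine hsum.trans (le_of_eq ?_)
    rw [norm_sub_sq_real, norm_labelDirection hn, norm_smul, inner_smul_right, hv, mul_pow,
      Real.norm_eq_abs, sq_abs, intCast_unit_sq]
    ring
  have habs : |inner ℝ (labelDirection l) v| ≤ 1 := by
    have := abs_real_inner_le_norm (labelDirection l) v
    rwa [norm_labelDirection hn, hv, mul_one] at this
  rw [abs_le] at habs
  rcases le_total 0 (inner ℝ (labelDirection l) v) with h | h
  · have := key 1
    simp only [Units.val_one, Int.cast_one, one_mul] at this
    nlinarith
  · have := key (-1)
    simp only [Units.val_neg, Units.val_one, Int.cast_neg, Int.cast_one] at this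
    nlinarith

theorem misclassificationRate_nonneg {n : ℕ} (l lhat : Fin n → ℤˣ) :
    0 ≤ misclassificationRate l lhat := by
  unfold misclassificationRate
  positivity

theorem measurable_sgnLabel (s₀ : ℤˣ) : Measurable (sgnLabel s₀) :=
  Measurable.ite measurableSet_Ioi measurable_const
    (Measurable.ite measurableSet_Iio measurable_const measurable_const)

/-- On the event that `v` is a first right singular vector, the misclassification rate is bounded
by quadratic functionals of the noise. -/
theorem misclassificationRate_le_of_isFirstRightSingularVector {n p : ℕ} (hn : 1 ≤ n)
    (l : Fin n → ℤˣ) (s₀ : ℤˣ) {μ : EuclideanSpace ℝ (Fin p)} (hμ : 0 < ‖μ‖)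
    (z : Fin n → EuclideanSpace ℝ (Fin p)) {v : EuclideanSpace ℝ (Fin n)}
    (hv : IsFirstRightSingularVector (dataMatrix l μ z) v) :
    misclassificationRate l (fun i => sgnLabel s₀ (v i)) ≤
      2 / (n * ‖μ‖ ^ 2) ^ 2 * (8 * n * ∑ i, inner ℝ μ (z i) ^ 2 +
        16 * ‖(columnMap z).adjoint ∘L columnMap z -
          (p : ℝ) • ContinuousLinearMap.id ℝ (EuclideanSpace ℝ (Fin n))‖ ^ 2) := by
  obtain ⟨hv1, u, hu, hAv, -⟩ := hv
  have hn0 : (0 : ℝ) < n := by positivity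
  have hmax := norm_apply_le_singularValues_zero_mul (dataMatrix l μ z).toEuclideanLin
    (labelDirection l)
  have hnv : ‖(dataMatrix l μ z).toEuclideanLin v‖ =
      (dataMatrix l μ z).toEuclideanLin.singularValues 0 := by
    rw [hAv, norm_smul, hu, mul_one, Real.norm_of_nonneg (LinearMap.singularValues_nonneg _ _)]
  rw [norm_labelDirection hn, mul_one, ← hnv, toEuclideanLin_dataMatrix_apply hn,
    toEuclideanLin_dataMatrix_apply hn] at hmax
  have h := one_sub_inner_sq_le_of_isMax (columnMap z) μ (√n) p (Real.sqrt_nonneg _) hv1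
    (norm_labelDirection hn l) hmax
  rw [Real.sq_sqrt hn0.le, norm_sq_adjoint_columnMap] at h
  refine (misclassificationRate_le_two_mul hn l s₀ v hv1).trans ?_
  rw [div_mul_eq_mul_div, le_div_iff₀ (by positivity)]
  linarith

theorem theorem5 :
    ∃ Cgap : ℝ, 0 < Cgap ∧ ∃ C : ℝ, 0 < C ∧
      ∀ (n p : ℕ), 1 ≤ n → n ≤ p →
      ∀ (l : Fin n → ℤˣ) (μ : EuclideanSpace ℝ (Fin p)),
        Cgap * ((p : ℝ) / n) ^ (1 / 4 : ℝ) ≤ ‖μ‖ →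
      ∀ (Ω : Type*) [MeasurableSpace Ω] (P : Measure Ω) [IsProbabilityMeasure P]
        (Z : Fin n → Ω → EuclideanSpace ℝ (Fin p)),
        (∀ i, HasLaw (Z i) (stdGaussian (EuclideanSpace ℝ (Fin p))) P) → iIndepFun Z P →
      ∀ (vhat : Ω → EuclideanSpace ℝ (Fin n)), AEMeasurable vhat P →
        (∀ᵐ ω ∂P, IsFirstRightSingularVector (dataMatrix l μ fun i => Z i ω) (vhat ω)) →
      ∀ s₀ : ℤˣ,
        Integrable (fun ω => misclassificationRate l fun i => sgnLabel s₀ (vhat ω i)) P ∧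
        ∫ ω, misclassificationRate l (fun i => sgnLabel s₀ (vhat ω i)) ∂P ≤
          C * ((n * ‖μ‖ ^ 2 + p) / (n * ‖μ‖ ^ 4)) := by
  -- the bound holds for every nonzero `μ`, so the gap constant is immaterial
  refine ⟨1, one_pos, 32 * 77824, by norm_num, ?_⟩
  intro n p hn hnp l μ hgap Ω _ P _ Z hZ hind vhat hvm hv s₀
  have hn0 : (0 : ℝ) < n := by positivity
  have hp0 : (0 : ℝ) < p := hn0.trans_le (by exact_mod_cast hnp)
  have hμ : 0 < ‖μ‖ := lt_of_lt_of_le (by positivity) hgap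
  obtain ⟨H, hHint, hHle, hH⟩ := exists_integrable_majorant_opNorm_sq hn hnp hZ hind
  have hcross := fun i => integrable_and_integral_inner_sq_stdGaussian (hZ i) μ
  have hsum : Integrable (fun ω => ∑ i, inner ℝ μ (Z i ω) ^ 2) P :=
    integrable_finsetSum _ fun i _ => (hcross i).1
  have hsumval : ∫ ω, ∑ i, inner ℝ μ (Z i ω) ^ 2 ∂P = n * ‖μ‖ ^ 2 := by
    rw [integral_finsetSum _ fun i _ => (hcross i).1]
    simp [(hcross _).2]
  let B : Ω → ℝ := fun ω => 2 / (n * ‖μ‖ ^ 2) ^ 2 *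
    (8 * n * ∑ i, inner ℝ μ (Z i ω) ^ 2 + 16 * H ω)
  have hBint : Integrable B P := ((hsum.const_mul _).add (hHint.const_mul _)).const_mul _
  have hle : ∀ᵐ ω ∂P, misclassificationRate l (fun i => sgnLabel s₀ (vhat ω i)) ≤ B ω := by
    filter_upwards [hv] with ω hω
    refine (misclassificationRate_le_of_isFirstRightSingularVector hn l s₀ hμ _ hω).trans ?_
    change _ ≤ 2 / (n * ‖μ‖ ^ 2) ^ 2 * (8 * n * ∑ i, inner ℝ μ (Z i ω) ^ 2 + 16 * H ω)
    gcongr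
    exact hH ω
  have hmeas : AEStronglyMeasurable
      (fun ω => misclassificationRate l fun i => sgnLabel s₀ (vhat ω i)) P := by
    have : MeasurableSingletonClass ℤˣ :=
      ⟨fun u => ⟨{(u : ℤ)}, measurableSet_singleton _, by ext; simp [Units.ext_iff]⟩⟩
    have h1 : Measurable fun v : EuclideanSpace ℝ (Fin n) => fun i => sgnLabel s₀ (v i) :=
      measurable_pi_lambda _ fun i => (measurable_sgnLabel s₀).comp (by fun_prop)
    have h2 : Measurable (misclassificationRate l) := measurable_of_countable _
    exact ((h2.comp h1).comp_aemeasurable hvm).aestronglyMeasurable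
  have hint : Integrable (fun ω => misclassificationRate l fun i => sgnLabel s₀ (vhat ω i)) P := by
    refine hBint.mono' hmeas ?_
    filter_upwards [hle] with ω hω
    rwa [Real.norm_of_nonneg (misclassificationRate_nonneg _ _)]
  refine ⟨hint, (integral_mono_ae hint hBint hle).trans ?_⟩
  have hB : ∫ ω, B ω ∂P = 2 / (n * ‖μ‖ ^ 2) ^ 2 *
      (8 * n * (n * ‖μ‖ ^ 2) + 16 * ∫ ω, H ω ∂P) := by
    rw [integral_const_mul, integral_add (hsum.const_mul _) (hHint.const_mul _),
      integral_const_mul, integral_const_mul, hsumval]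
  rw [hB]
  calc 2 / (n * ‖μ‖ ^ 2) ^ 2 * (8 * n * (n * ‖μ‖ ^ 2) + 16 * ∫ ω, H ω ∂P)
      ≤ 2 / (n * ‖μ‖ ^ 2) ^ 2 * (8 * 155648 * n * (n * ‖μ‖ ^ 2) + 16 * (77824 * (p * n))) := by
        gcongr
        nlinarith [show 0 ≤ (n : ℝ) * (n * ‖μ‖ ^ 2) by positivity]
    _ = 32 * 77824 * ((n * ‖μ‖ ^ 2 + p) / (n * ‖μ‖ ^ 4)) := by
        field_simp
        ring
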